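/- Let $G$ be a countable (discrete) sofic group, and let $\Sigma=\{\sigma_i:G\to\mathrm{Sym}(d_i)\}_{i\ge 1}$ be a sofic approximation sequence for $G$, i.e. $d_i\in\{1,2,\dots\}$, $d_i\to\infty$, $|\{a\in[d_i]:\sigma_i(s)\sigma_i(t)(a)=\sigma_i(st)(a)\}|/d_i\to 1$ for all $s,t\in G$, and $|\{a\in[d_i]:\sigma_i(s)(a)=\sigma_i(t)(a)\}|/d_i\to 0$ for all distinct $s,t\in G$, where $[d]=\{1,\dots,d\}$. For a finite open cover $\mathcal U$ of a compact space $Y$, let $\mathcal D(\mathcal U)$ be the infimum, over all finite open covers $\mathcal V$ of $Y$ refining $\mathcal U$, of $\max_{y\in Y}\sum_{V\in\mathcal V}1_V(y)-1$ (with $\mathcal D(\mathcal U)=-\infty$ if $Y=\emptyset$). Let $G$ act continuously on a compact metrizable space $X$ with compatible metric $\rho$. For a nonempty finite set $F\subseteq G$, $\delta>0$ and $\sigma:G\to\mathrm{Sym}(d)$, let $\mathrm{Map}(\rho,F,\delta,\sigma)$ be the set of all maps $\varphi:[d]\to X$ with $\bigl(\frac1d\sum_{a\in[d]}\rho(\varphi(\sigma(s)a),s\varphi(a))^2\bigr)^{1/2}\le\delta$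 for all $s\in F$, viewed as a closed subspace of $X^{[d]}$. For a finite open cover $\mathcal U$ of $X$, let $\mathcal U^d=\{U_1\times\dots\times U_d: U_1,\dots,U_d\in\mathcal U\}$. The sofic mean topological dimension of the action is $$\mathrm{mdim}_\Sigma(X)=\sup_{\mathcal U}\ \inf_{F}\ \inf_{\delta>0}\ \limsup_{i\to\infty}\frac{\mathcal D\bigl(\mathcal U^{d_i}|_{\mathrm{Map}(\rho,F,\delta,\sigma_i)}\bigr)}{d_i}\in[-\infty,+\infty],$$ where $\mathcal U$ ranges over the finite open covers of $X$ and $F$ over the nonempty finite subsets of $G$, and the upper limit is $-\infty$ if $\mathrm{Map}(\rho,F,\delta,\sigma_i)=\emptyset$ for all sufficiently large $i$; the value does not depend on the choice of $\rho$. A factor map between continuous $G$-actions on compact metrizable spaces is a continuous $G$-equivariant surjection; its target is called a factor of its source. **Proposition.** Let $G$ act continuously on a compact metrizable space $X$ with $\mathrm{mdim}_\Sigma(X)\ge 0$. Then $X$ has a largest factor $Y$ satisfying $\mathrm{mdim}_\Sigma(Y)=0$. That is, there are a continuous action of $G$ on a compact metrizable space $Y$ and a factor map $\pi:X\to Y$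 such that $\mathrm{mdim}_\Sigma(Y)=0$ and, for every continuous action of $G$ on a compact metrizable space $Z$ with $\mathrm{mdim}_\Sigma(Z)=0$ and every factor map $\pi_Z:X\to Z$, there is a unique factor map $\theta:Y\to Z$ with $\theta\circ\pi=\pi_Z$. -/

import Mathlib

open Filter Topology

universe u v

/-- A sofic approximation sequence `Σ = {σ_i : G → Sym(d_i)}` of the (discrete) group `G`:
asymptotically multiplicative, asymptotically free, and with `d_i → ∞`. -/
structure SoficApproximation (G : Type v) [Group G] where
  d : ℕ → ℕ
  d_pos : ∀ i, 0 < d i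
  σ : ∀ i, G → Equiv.Perm (Fin (d i))
  tendsto_mul : ∀ s t : G,
    Tendsto (fun i => (Set.ncard {a | σ i s (σ i t a) = σ i (s * t) a} : ℝ) / (d i : ℝ))
      atTop (𝓝 1)
  tendsto_free : ∀ s t : G, s ≠ t →
    Tendsto (fun i => (Set.ncard {a | σ i s a = σ i t a} : ℝ) / (d i : ℝ)) atTop (𝓝 0)
  tendsto_d : Tendsto d atTop atTop

namespace SoficMeanDim

section Covers

/-- `U` is a finite open cover of `Y`. -/
structure IsFiniteOpenCover {Y : Type*} [TopologicalSpace Y] (U : Set (Set Y)) : Prop where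
  finite : U.Finite
  isOpen : ∀ u ∈ U, IsOpen u
  sUnion_eq : ⋃₀ U = Set.univ

/-- `V` refines `U`: every member of `V` is contained in some member of `U`. -/
def Refines {Y : Type*} (V U : Set (Set Y)) : Prop :=
  ∀ v ∈ V, ∃ u ∈ U, v ⊆ u

/-- `ord(U) = max_y ∑_{u ∈ U} 1_u(y) - 1` for a finite family `U`
(equal to `-∞` when `Y` is empty, the maximum over the empty set). -/
noncomputable def coverOrd {Y : Type*} (U : Set (Set Y)) : EReal :=
  ⨆ y : Y, (((Set.ncard {u | u ∈ U ∧ y ∈ u} : ℝ) - 1 : ℝ) : EReal)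

/-- `𝒟(U)`: the infimum of `ord(V)` over the finite open covers `V` refining `U`. -/
noncomputable def coverD {Y : Type*} [TopologicalSpace Y] (U : Set (Set Y)) : EReal :=
  ⨅ (V : Set (Set Y)) (_ : IsFiniteOpenCover V ∧ Refines V U), coverOrd V

/-- The family `U^d` of all boxes `U_1 × ⋯ × U_d` in `X^d` with all `U_a ∈ U`. -/
def coverPow {X : Type*} (U : Set (Set X)) (d : ℕ) : Set (Set (Fin d → X)) :=
  {W | ∃ f : Fin d → Set X, (∀ a, f a ∈ U) ∧ W = Set.pi Set.univ f}

/-- The restriction `U|_S` of a family of subsets of `Y` to a subset `S`. -/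
def restrictCover {Y : Type*} (U : Set (Set Y)) (S : Set Y) : Set (Set S) :=
  (fun u => (Subtype.val ⁻¹' u : Set S)) '' U

end Covers

section Dimension

/-- `ρ` is a metric on `X` inducing the given topology. -/
def IsCompatibleMetric {X : Type*} [t : TopologicalSpace X] (ρ : X → X → ℝ) : Prop :=
  ∃ m : MetricSpace X, m.toUniformSpace.toTopologicalSpace = t ∧ ∀ x y, m.dist x y = ρ x y

/-- The distance `ρ₂` on maps `[d] → X`. -/
noncomputable def rhoTwo {X : Type*} (ρ : X → X → ℝ) {d : ℕ} (φ ψ : Fin d → X) : ℝ :=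
  Real.sqrt ((1 / (d : ℝ)) * ∑ a : Fin d, (ρ (φ a) (ψ a)) ^ 2)

/-- `Map(ρ, F, δ, σ)`: the approximately equivariant maps `[d] → X`. -/
def approxMaps {G : Type v} {X : Type*} [SMul G X] (ρ : X → X → ℝ) (F : Finset G) (δ : ℝ)
    {d : ℕ} (σ : G → Equiv.Perm (Fin d)) : Set (Fin d → X) :=
  {φ | ∀ s ∈ F, rhoTwo ρ (fun a => φ (σ s a)) (fun a => s • φ a) ≤ δ}

variable {G : Type v} [Group G] (S : SoficApproximation G)

/-- `𝒟_Σ(U, ρ, F, δ)`. Since `𝒟` of a cover of the empty space is `-∞`, the indices `i` for which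
`Map(ρ, F, δ, σ_i)` is empty do not contribute to the upper limit, and the value is `-∞` exactly
when these sets are empty for all large `i`. -/
noncomputable def soficDFδ {X : Type*} [TopologicalSpace X] [SMul G X] (ρ : X → X → ℝ)
    (U : Set (Set X)) (F : Finset G) (δ : ℝ) : EReal :=
  limsup (fun i : ℕ =>
    coverD (restrictCover (coverPow U (S.d i)) (approxMaps ρ F δ (S.σ i))) / (S.d i : EReal))
    atTop

/-- `𝒟_Σ(U, ρ, F)`. -/
noncomputable def soficDF {X : Type*} [TopologicalSpace X] [SMul G X] (ρ : X → X → ℝ)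
    (U : Set (Set X)) (F : Finset G) : EReal :=
  ⨅ (δ : ℝ) (_ : 0 < δ), soficDFδ S ρ U F δ

/-- `𝒟_Σ(U, ρ)`. -/
noncomputable def soficD {X : Type*} [TopologicalSpace X] [SMul G X] (ρ : X → X → ℝ)
    (U : Set (Set X)) : EReal :=
  ⨅ (F : Finset G) (_ : F.Nonempty), soficDF S ρ U F

/-- `mdim_Σ(X, ρ)`: the sofic mean topological dimension computed with the metric `ρ`. -/
noncomputable def mdimWith {X : Type*} [TopologicalSpace X] [SMul G X] (ρ : X → X → ℝ) : EReal :=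
  ⨆ (U : Set (Set X)) (_ : IsFiniteOpenCover U), soficD S ρ U

/-- `mdim_Σ(X)`: the sofic mean topological dimension of an action on a metrizable space, computed
with some compatible metric; by `mdim_eq_mdimWith` below every compatible metric gives the same
value when `X` is compact. -/
noncomputable def mdim (X : Type*) [TopologicalSpace X] [TopologicalSpace.MetrizableSpace X]
    [SMul G X] : EReal :=
  mdimWith (X := X) S (TopologicalSpace.metrizableSpaceMetric X).dist

end Dimension

/-- `π : X → Y` is a factor map of `G`-actions: a continuous equivariant surjection. -/
structure IsFactorMap (G : Type v) {X Y : Type*} [TopologicalSpace X] [TopologicalSpace Y]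
    [SMul G X] [SMul G Y] (π : X → Y) : Prop where
  continuous : Continuous π
  surjective : Function.Surjective π
  map_smul : ∀ (g : G) (x : X), π (g • x) = g • π x

section Independence

theorem coverD_mono {Y : Type*} [TopologicalSpace Y] (U : Set (Set Y)) {A B : Set Y}
    (h : A ⊆ B) : coverD (restrictCover U A) ≤ coverD (restrictCover U B) := by
  refine le_iInf₂ fun V hV => ?_
  have hc : Continuous (Set.inclusion h) := continuous_inclusion h
  refine (iInf₂_le ((fun v => Set.inclusion h ⁻¹' v) '' V) ⟨⟨?_, ?_, ?_⟩, ?_⟩).trans ?_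
  rotate_left
  · exact hV.1.finite.image _
  · rintro _ ⟨v, hv, rfl⟩
    exact (hV.1.isOpen v hv).preimage hc
  · rw [Set.eq_univ_iff_forall]
    intro y
    have hy : Set.inclusion h y ∈ ⋃₀ V := by rw [hV.1.sUnion_eq]; trivial
    obtain ⟨v, hv, hyv⟩ := hy
    exact ⟨_, ⟨v, hv, rfl⟩, hyv⟩
  · rintro _ ⟨v, hv, rfl⟩
    obtain ⟨_, ⟨u, hu, rfl⟩, hvu⟩ := hV.2 v hv
    exact ⟨_, ⟨u, hu, rfl⟩, fun y hy => hvu hy⟩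
  · refine iSup_le fun y => le_trans ?_ (le_iSup _ (Set.inclusion h y))
    have hfin : {v | v ∈ V ∧ Set.inclusion h y ∈ v}.Finite :=
      hV.1.finite.subset fun v hv => hv.1
    have h1 : {u | u ∈ (fun v => Set.inclusion h ⁻¹' v) '' V ∧ y ∈ u} ⊆
        (fun v => Set.inclusion h ⁻¹' v) '' {v | v ∈ V ∧ Set.inclusion h y ∈ v} := by
      rintro _ ⟨⟨v, hv, rfl⟩, hy⟩
      exact ⟨v, ⟨hv, hy⟩, rfl⟩
    have h2 := (Set.ncard_le_ncard h1 (hfin.image _)).trans (Set.ncard_image_le hfin)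
    have h3 : (Set.ncard {u | u ∈ (fun v => Set.inclusion h ⁻¹' v) '' V ∧ y ∈ u} : ℝ) ≤
        (Set.ncard {v | v ∈ V ∧ Set.inclusion h y ∈ v} : ℝ) := by exact_mod_cast h2
    exact EReal.coe_le_coe_iff.2 (by linarith)

theorem sq_le_add_mul_sq {X : Type*} [t : TopologicalSpace X] [CompactSpace X]
    {ρ ρ' : X → X → ℝ} (hρ : IsCompatibleMetric ρ) (hρ' : IsCompatibleMetric ρ') {ε : ℝ}
    (hε : 0 < ε) : ∃ C : ℝ, 0 ≤ C ∧ ∀ x y, ρ' x y ^ 2 ≤ ε + C * ρ x y ^ 2 := by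
  obtain ⟨m, hm, hmρ⟩ := hρ
  obtain ⟨m', hm', hmρ'⟩ := hρ'
  have hc : Continuous fun p : X × X => ρ p.1 p.2 := by
    have := @continuous_dist X m.toPseudoMetricSpace
    rw [hm] at this
    simpa only [hmρ] using this
  have hc' : Continuous fun p : X × X => ρ' p.1 p.2 := by
    have := @continuous_dist X m'.toPseudoMetricSpace
    rw [hm'] at this
    simpa only [hmρ'] using this
  have hK : IsCompact {p : X × X | ε ≤ ρ' p.1 p.2 ^ 2} :=
    (isClosed_le continuous_const (hc'.pow 2)).isCompact
  have hpos : ∀ p ∈ {p : X × X | ε ≤ ρ' p.1 p.2 ^ 2}, 0 < ρ p.1 p.2 ^ 2 := by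
    rintro ⟨x, y⟩ hp
    have hne : x ≠ y := by
      rintro rfl
      have h0 : ρ' x x = 0 := by rw [← hmρ']; exact @dist_self X m'.toPseudoMetricSpace x
      simp only [Set.mem_ofPred_eq, h0] at hp
      norm_num at hp
      linarith
    have : 0 < ρ x y := by rw [← hmρ]; exact (@dist_pos X m x y).2 hne
    exact pow_pos this 2
  rcases Set.eq_empty_or_nonempty {p : X × X | ε ≤ ρ' p.1 p.2 ^ 2} with he | hne
  · refine ⟨0, le_rfl, fun x y => ?_⟩
    have : (x, y) ∉ {p : X × X | ε ≤ ρ' p.1 p.2 ^ 2} := by rw [he]; exact Set.notMem_empty _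
    simp only [Set.mem_ofPred_eq, not_le] at this
    linarith
  · obtain ⟨p, hp, hmin⟩ := hK.exists_isMinOn hne (hc.pow 2).continuousOn
    obtain ⟨q, hq, hmax⟩ := hK.exists_isMaxOn hne (hc'.pow 2).continuousOn
    have h0 := hpos p hp
    refine ⟨ρ' q.1 q.2 ^ 2 / ρ p.1 p.2 ^ 2, by positivity, fun x y => ?_⟩
    by_cases hxy : ε ≤ ρ' x y ^ 2
    · have h1 : ρ p.1 p.2 ^ 2 ≤ ρ x y ^ 2 := hmin (show (x, y) ∈ _ from hxy)
      have h2 : ρ' x y ^ 2 ≤ ρ' q.1 q.2 ^ 2 := hmax (show (x, y) ∈ _ from hxy)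
      have h3 : ρ' q.1 q.2 ^ 2 ≤ ρ' q.1 q.2 ^ 2 / ρ p.1 p.2 ^ 2 * ρ x y ^ 2 := by
        rw [div_mul_eq_mul_div, le_div_iff₀ h0]
        exact mul_le_mul_of_nonneg_left h1 (sq_nonneg _)
      linarith
    · have : 0 ≤ ρ' q.1 q.2 ^ 2 / ρ p.1 p.2 ^ 2 * ρ x y ^ 2 := by positivity
      linarith [not_le.1 hxy]

theorem exists_approxMaps_subset {G : Type v} {X : Type*} [TopologicalSpace X] [CompactSpace X]
    [SMul G X] {ρ ρ' : X → X → ℝ} (hρ : IsCompatibleMetric ρ) (hρ' : IsCompatibleMetric ρ')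
    {δ : ℝ} (hδ : 0 < δ) : ∃ δ' : ℝ, 0 < δ' ∧ ∀ (F : Finset G) (d : ℕ)
      (σ : G → Equiv.Perm (Fin d)), approxMaps (X := X) ρ F δ' σ ⊆ approxMaps ρ' F δ σ := by
  obtain ⟨C, hC, hle⟩ := sq_le_add_mul_sq hρ hρ' (show 0 < δ ^ 2 / 2 by positivity)
  refine ⟨Real.sqrt (δ ^ 2 / (2 * (C + 1))), by positivity, fun F d σ φ hφ s hs => ?_⟩
  have h1 := hφ s hs
  unfold rhoTwo at h1 ⊢
  rw [Real.sqrt_le_sqrt_iff (by positivity), le_div_iff₀ (by positivity)] at h1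
  refine Real.sqrt_le_iff.2 ⟨hδ.le, ?_⟩
  have h2 : ∑ a : Fin d, ρ' (φ (σ s a)) (s • φ a) ^ 2 ≤
      d * (δ ^ 2 / 2) + C * ∑ a : Fin d, ρ (φ (σ s a)) (s • φ a) ^ 2 := by
    calc _ ≤ ∑ a : Fin d, (δ ^ 2 / 2 + C * ρ (φ (σ s a)) (s • φ a) ^ 2) :=
          Finset.sum_le_sum fun a _ => hle _ _
      _ = _ := by simp [Finset.sum_add_distrib, Finset.mul_sum]
  have h3 := mul_le_mul_of_nonneg_left h2 (show (0 : ℝ) ≤ 1 / d by positivity)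
  have h4 : 1 / (d : ℝ) * (d * (δ ^ 2 / 2)) ≤ δ ^ 2 / 2 := by
    rcases Nat.eq_zero_or_pos d with rfl | hd
    · simp; positivity
    · have : (d : ℝ) ≠ 0 := by positivity
      field_simp
      exact le_rfl
  have h5 : 0 ≤ 1 / (d : ℝ) * ∑ a : Fin d, ρ (φ (σ s a)) (s • φ a) ^ 2 := by positivity
  nlinarith

theorem soficDF_le {G : Type v} [Group G] (S : SoficApproximation G) {X : Type*}
    [TopologicalSpace X] [CompactSpace X] [SMul G X] {ρ ρ' : X → X → ℝ}
    (hρ : IsCompatibleMetric ρ) (hρ' : IsCompatibleMetric ρ') (U : Set (Set X)) (F : Finset G) :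
    soficDF S ρ U F ≤ soficDF S ρ' U F := by
  refine le_iInf₂ fun δ hδ => ?_
  obtain ⟨δ', hδ', hsub⟩ := exists_approxMaps_subset (G := G) hρ hρ' hδ
  refine (iInf₂_le δ' hδ').trans (limsup_le_limsup (Eventually.of_forall fun i => ?_))
  exact EReal.div_le_div_right_of_nonneg (by positivity) (coverD_mono _ (hsub F _ _))

/-- The sofic mean topological dimension does not depend on the compatible metric. -/
theorem mdim_eq_mdimWith {G : Type v} [Group G] (S : SoficApproximation G) {X : Type*}
    [TopologicalSpace X] [CompactSpace X] [TopologicalSpace.MetrizableSpace X] [SMul G X]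
    {ρ : X → X → ℝ} (hρ : IsCompatibleMetric ρ) : mdim S X = mdimWith S ρ := by
  have h0 : IsCompatibleMetric (TopologicalSpace.metrizableSpaceMetric X).dist :=
    ⟨TopologicalSpace.metrizableSpaceMetric X, rfl, fun _ _ => rfl⟩
  refine iSup_congr fun U => iSup_congr fun _ => iInf_congr fun F => iInf_congr fun _ => ?_
  exact le_antisymm (soficDF_le S h0 hρ U F) (soficDF_le S hρ h0 U F)

end Independence

end SoficMeanDim

/-!
The largest factor with mean dimension zero is the image `Y` of `X` in the product of its factors of
nonpositive mean dimension. The separated pairs of a factor form an open subset of the second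
countable space `X × X`, so countably many of these factors separate as many points as all of them
(`NonposFactor.exists_countable_separated`); using only those keeps the product metrizable. Every
factor in question is constant on the fibres of `X → Y`, and `X → Y` is a quotient map, which gives
the universal property.

What has to be proved is that `Y` has mean dimension zero. It is nonnegative because approximately
equivariant maps into `X` push forward to `Y` (`mdim_nonneg_iff`, `mdim_nonneg_of_map`). It is
nonpositive because nonpositivity is inherited by any system that equivariant maps into such systems
separate (`mdim_nonpos_of_separating`). Indeed a finite open cover of `Y` is refined by the join of
covers pulled back from finitely many targets (`exists_finset_covers_of_separating`), and `𝒟` is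
subadditive under joins (`coverD_le_sum`).

The subadditivity is `exists_common_refinement`. For covers `V n`, take functions
`f n v : M → [0, 1]` with `{f n v > 0} ⊆ v` such that at each point, for every `n`, some `f n v`
equals `1`. To a set `S` of indices `(n, v)` meeting every `V n`, attach the open set where the
functions in `S` are positive and exceed all the others. These sets refine the join, and they cover
`M`: use the functions with value `1`. The index sets `S` whose open set contains a given point `x`
form a chain, and lie between the sizes `#ι` and `∑ n, #{v ∈ V n | x ∈ v}`; hence there are at most
`1 + ∑ n, (#{v ∈ V n | x ∈ v} - 1)` of them. This is the triangulation of a product of simplices by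
chains, written without polyhedra.
-/

namespace SoficMeanDim

/-! ### Joins of finite open covers -/

/-- A bump-function form of the shrinking lemma. The functions peak at the common value `1` at
every point of the space, so the level sets of functions belonging to different covers can be
compared. -/
theorem IsFiniteOpenCover.exists_bump {M : Type*} [TopologicalSpace M] [NormalSpace M]
    {V : Set (Set M)} (hV : IsFiniteOpenCover V) :
    ∃ f : V → C(M, ℝ), (∀ v x, f v x ≤ 1) ∧ (∀ v x, 0 < f v x → x ∈ v.1) ∧
      ∀ x, ∃ v, f v x = 1 := by
  have := hV.finite.to_subtype
  obtain ⟨c, hc, hcl, hsub⟩ := exists_iUnion_eq_closed_subset (u := fun v : V => v.1)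
    (fun v => hV.isOpen v v.2) (fun x => Set.toFinite _)
    (by rw [← Set.sUnion_eq_iUnion, hV.sUnion_eq])
  have h := fun v : V => exists_continuous_zero_one_of_isClosed
    (hV.isOpen v v.2).isClosed_compl (hcl v)
    (Set.disjoint_left.2 fun x hx hx' => hx (hsub v hx'))
  choose f h0 h1 h01 using h
  refine ⟨f, fun v x => (h01 v x).2, fun v x hx => ?_, fun x => ?_⟩
  · by_contra hxv
    exact hx.ne' (h0 v hxv)
  · obtain ⟨v, hv⟩ := Set.mem_iUnion.1 (hc.symm ▸ Set.mem_univ x : x ∈ Set.iUnion c)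
    exact ⟨v, h1 v hv⟩

/-- Subadditivity of the order under joins, in a pointwise form: finitely many finite open covers
of a normal space have a common refinement whose order at each point is at most the sum of their
orders there. -/
theorem exists_common_refinement {M : Type*} [TopologicalSpace M] [NormalSpace M] {ι : Type*}
    [Fintype ι] (V : ι → Set (Set M)) (hV : ∀ n, IsFiniteOpenCover (V n)) :
    ∃ W : Set (Set M), IsFiniteOpenCover W ∧ (∀ w ∈ W, ∀ n, ∃ v ∈ V n, w ⊆ v) ∧
      ∀ x, (Set.ncard {w | w ∈ W ∧ x ∈ w} : ℝ) - 1 ≤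
        ∑ n, ((Set.ncard {v | v ∈ V n ∧ x ∈ v} : ℝ) - 1) := by
  classical
  have hfin : ∀ n, Finite (V n) := fun n => (hV n).finite.to_subtype
  have := fun n => Fintype.ofFinite (V n)
  choose f hle hpos hone using fun n => (hV n).exists_bump
  -- `box S` is where the functions indexed by `S` are positive and strictly dominate the others.
  let box : Finset (Σ n, V n) → Set M := fun S =>
    {x | ∀ i ∈ S, 0 < f i.1 i.2 x ∧ ∀ j, j ∉ S → f j.1 j.2 x < f i.1 i.2 x}
  have hbox : ∀ S, IsOpen (box S) := by
    intro S
    have : box S = ⋂ i ∈ S, ({x | 0 < f i.1 i.2 x} ∩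
        ⋂ j : {j // j ∉ S}, {x | f j.1.1 j.1.2 x < f i.1 i.2 x}) := by
      ext x; simp [box]
    rw [this]
    refine isOpen_biInter_finset fun i _ => IsOpen.inter ?_ (isOpen_iInter_of_finite fun j => ?_)
    · exact isOpen_lt continuous_const (f i.1 i.2).continuous
    · exact isOpen_lt (f j.1.1 j.1.2).continuous (f i.1 i.2).continuous
  refine ⟨box '' {S | ∀ n, ∃ v, ⟨n, v⟩ ∈ S}, ⟨(Set.toFinite _).image _, ?_, ?_⟩, ?_, ?_⟩
  · rintro _ ⟨S, -, rfl⟩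
    exact hbox S
  · -- Every point lies in the box of the functions equal to `1` there.
    refine Set.eq_univ_iff_forall.2 fun x => ?_
    refine ⟨_, ⟨Finset.univ.filter fun i => f i.1 i.2 x = 1, fun n => ?_, rfl⟩, ?_⟩
    · obtain ⟨v, hv⟩ := hone n x
      exact ⟨v, by simpa using hv⟩
    · intro i hi
      have hi : f i.1 i.2 x = 1 := by simpa using hi
      refine ⟨by rw [hi]; exact one_pos, fun j hj => ?_⟩
      rw [hi]
      exact lt_of_le_of_ne (hle _ _ _) (by simpa using hj)
  · rintro _ ⟨S, hS, rfl⟩ n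
    obtain ⟨v, hv⟩ := hS n
    exact ⟨v, v.2, fun x hx => hpos n v x (hx _ hv).1⟩
  · intro x
    set P : Finset (Finset (Σ n, V n)) :=
      Finset.univ.filter fun S => (∀ n, ∃ v, ⟨n, v⟩ ∈ S) ∧ x ∈ box S with hP
    set T : Finset (Σ n, V n) := Finset.univ.sigma fun n => Finset.univ.filter fun v => x ∈ v.1
      with hT
    have h1 : Set.ncard {w | w ∈ box '' {S | ∀ n, ∃ v, ⟨n, v⟩ ∈ S} ∧ x ∈ w} ≤ P.card := by
      have hsub : {w | w ∈ box '' {S | ∀ n, ∃ v, ⟨n, v⟩ ∈ S} ∧ x ∈ w} ⊆ box '' (P : Set _) := by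
        rintro _ ⟨⟨S, hS, rfl⟩, hx⟩
        refine ⟨S, ?_, rfl⟩
        rw [Finset.mem_coe, hP, Finset.mem_filter]
        exact ⟨Finset.mem_univ _, hS, hx⟩
      refine (Set.ncard_le_ncard hsub ((Finset.finite_toSet P).image _)).trans ?_
      refine (Set.ncard_image_le (Finset.finite_toSet P)).trans ?_
      rw [Set.ncard_coe_finset]
    -- Distinct boxes through `x` come from nested index sets, hence from sets of distinct sizes.
    have hchain : ∀ S ∈ P, ∀ S' ∈ P, S.card = S'.card → S = S' := by
      intro S hS S' hS' hcard
      simp only [hP, Finset.mem_filter, Finset.mem_univ, true_and] at hS hS'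
      by_contra hne
      have h1 : ¬ S ⊆ S' := fun h => hne (Finset.eq_of_subset_of_card_le h hcard.ge)
      have h2 : ¬ S' ⊆ S := fun h => hne (Finset.eq_of_subset_of_card_le h hcard.le).symm
      obtain ⟨i, hi, hi'⟩ := Finset.not_subset.1 h1
      obtain ⟨j, hj, hj'⟩ := Finset.not_subset.1 h2
      exact lt_asymm ((hS.2 i hi).2 j hj') ((hS'.2 j hj).2 i hi')
    have hcardT : T.card = ∑ n, Set.ncard {v | v ∈ V n ∧ x ∈ v} := by
      rw [hT, Finset.card_sigma]
      refine Finset.sum_congr rfl fun n _ => ?_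
      rw [← Set.ncard_coe_finset, ← Set.ncard_image_of_injective _ Subtype.val_injective]
      congr 1
      ext v
      simp [and_comm]
    have hlow : ∀ S : Finset (Σ n, V n), (∀ n, ∃ v, ⟨n, v⟩ ∈ S) → Fintype.card ι ≤ S.card := by
      intro S hS
      choose v hv using hS
      exact Finset.card_le_card_of_injOn (s := Finset.univ) (fun n => ⟨n, v n⟩) (fun n _ => hv n)
        fun a _ b _ h => congrArg Sigma.fst h
    have h2 : P.card ≤ (Finset.Icc (Fintype.card ι) T.card).card := by
      refine Finset.card_le_card_of_injOn Finset.card (fun S hS => ?_)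
        fun S hS S' hS' => hchain S hS S' hS'
      have hS : (∀ n, ∃ v, ⟨n, v⟩ ∈ S) ∧ x ∈ box S := by simpa [hP] using hS
      refine Finset.mem_coe.2 (Finset.mem_Icc.2 ⟨hlow S hS.1, Finset.card_le_card fun i hi => ?_⟩)
      simpa [hT] using hpos _ _ _ (hS.2 i hi).1
    have h3 : Fintype.card ι ≤ T.card := by
      refine hlow T fun n => ?_
      obtain ⟨v, hv⟩ := hone n x
      exact ⟨v, by simpa [hT] using hpos n v x (hv ▸ one_pos)⟩
    rw [Nat.card_Icc] at h2
    have h4 : Set.ncard {w | w ∈ box '' {S | ∀ n, ∃ v, ⟨n, v⟩ ∈ S} ∧ x ∈ w} + Fintype.card ι ≤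
        (∑ n, Set.ncard {v | v ∈ V n ∧ x ∈ v}) + 1 := by omega
    have h5 : (Set.ncard {w | w ∈ box '' {S | ∀ n, ∃ v, ⟨n, v⟩ ∈ S} ∧ x ∈ w} : ℝ) +
        Fintype.card ι ≤ (∑ n, (Set.ncard {v | v ∈ V n ∧ x ∈ v} : ℝ)) + 1 := by exact_mod_cast h4
    rw [Finset.sum_sub_distrib]
    simp only [Finset.sum_const, Finset.card_univ, nsmul_eq_mul, mul_one]
    linarith

/-! ### Separating families and approximately equivariant maps -/

/-- Covers of a compact space are controlled by finitely many maps of a separating family, because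
the uniformity of the space is the coarsest one making all these maps uniformly continuous. -/
theorem exists_finset_covers_of_separating {Y : Type*} [TopologicalSpace Y] [CompactSpace Y]
    [Nonempty Y] {ι : Type*} {Z : ι → Type*} [∀ n, TopologicalSpace (Z n)]
    [∀ n, CompactSpace (Z n)] [∀ n, TopologicalSpace.MetrizableSpace (Z n)] (p : ∀ n, Y → Z n)
    (hp : ∀ n, Continuous (p n)) (hsep : ∀ x y, (∀ n, p n x = p n y) → x = y)
    {U : Set (Set Y)} (hU : IsFiniteOpenCover U) :
    ∃ (J : Finset ι) (O : ∀ n, Set (Set (Z n))), (∀ n, IsFiniteOpenCover (O n)) ∧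
      ∀ o : ∀ n, Set (Z n), (∀ n ∈ J, o n ∈ O n) → ∃ u ∈ U, ∀ y, (∀ n ∈ J, p n y ∈ o n) → y ∈ u := by
  classical
  let _ := fun n => TopologicalSpace.metrizableSpaceMetric (Z n)
  have hemb : IsClosedEmbedding fun y n => p n y :=
    (continuous_pi hp).isClosedEmbedding fun x y h => hsep x y fun n => congrFun h n
  let uY : UniformSpace Y := (⨅ n, UniformSpace.comap (p n) inferInstance).replaceTopology (by
    rw [UniformSpace.toTopologicalSpace_iInf, hemb.eq_induced, Pi.topologicalSpace, induced_iInf]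
    refine iInf_congr fun n => ?_
    rw [induced_compose]
    rfl)
  have huY : uniformity Y = ⨅ n, comap (fun q : Y × Y => (p n q.1, p n q.2)) (uniformity (Z n)) :=
    iInf_uniformity
  have hbasis := HasBasis.iInf' fun n =>
    (Metric.uniformity_basis_dist (α := Z n)).comap fun q : Y × Y => (p n q.1, p n q.2)
  rw [← huY] at hbasis
  obtain ⟨E, hE, hEU⟩ := lebesgue_number_lemma_sUnion (isCompact_univ (X := Y)) hU.isOpen
    hU.sUnion_eq.ge
  obtain ⟨⟨I, r⟩, ⟨hI, hr⟩, hIE⟩ := hbasis.mem_iff.1 hE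
  have hO : ∀ n, ∃ O : Set (Set (Z n)), IsFiniteOpenCover O ∧
      (n ∈ I → ∀ o ∈ O, ∀ a ∈ o, ∀ b ∈ o, dist a b < r n) := by
    intro n
    by_cases hn : n ∈ I
    · obtain ⟨t, -, ht, htc⟩ := (isCompact_univ (X := Z n)).finite_cover_balls
        (half_pos (hr n hn))
      refine ⟨(fun z => Metric.ball z (r n / 2)) '' t, ⟨ht.image _, ?_, ?_⟩, ?_⟩
      · rintro _ ⟨z, -, rfl⟩
        exact Metric.isOpen_ball
      · rw [Set.sUnion_image]
        exact Set.univ_subset_iff.1 htc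
      · rintro - _ ⟨z, -, rfl⟩ a ha b hb
        rw [Metric.mem_ball] at ha hb
        linarith [dist_triangle_right a b z]
    · exact ⟨{Set.univ}, ⟨Set.finite_singleton _, by simp, by simp⟩, fun h => absurd h hn⟩
  choose O hO hOr using hO
  refine ⟨hI.toFinset, O, hO, fun o ho => ?_⟩
  by_cases hex : ∃ x, ∀ n ∈ hI.toFinset, p n x ∈ o n
  · obtain ⟨x, hx⟩ := hex
    obtain ⟨u, hu, hxu⟩ := hEU x trivial
    refine ⟨u, hu, fun y hy => hxu (hIE ?_)⟩
    refine Set.mem_iInter₂.2 fun n hn => ?_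
    have hn' : n ∈ hI.toFinset := hI.mem_toFinset.2 hn
    exact hOr n hn (o n) (ho n hn') _ (hx n hn') _ (hy n hn')
  · obtain ⟨u, hu, -⟩ := hEU (Classical.arbitrary Y) trivial
    exact ⟨u, hu, fun y hy => absurd ⟨y, hy⟩ hex⟩

/-- The version of `sq_le_add_mul_sq` for a continuous map between two spaces. -/
theorem IsCompatibleMetric.exists_sq_le_add_mul_sq {X Z : Type*} [TopologicalSpace X]
    [CompactSpace X] [TopologicalSpace Z] {ρ : X → X → ℝ} {ρ' : Z → Z → ℝ}
    (hρ : IsCompatibleMetric ρ) (hρ' : IsCompatibleMetric ρ') {p : X → Z} (hp : Continuous p)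
    {ε : ℝ} (hε : 0 < ε) :
    ∃ C : ℝ, 0 ≤ C ∧ ∀ x y, ρ' (p x) (p y) ^ 2 ≤ ε + C * ρ x y ^ 2 := by
  obtain ⟨m, rfl, hmρ⟩ := hρ
  obtain ⟨m', rfl, hmρ'⟩ := hρ'
  -- The metric induced by the graph of `p` is again compatible, and dominates `ρ' ∘ p`.
  have key : IsCompatibleMetric fun x y => max (ρ x y) (ρ' (p x) (p y)) := by
    refine ⟨(isEmbedding_graph hp).comapMetricSpace _, rfl, fun x y => ?_⟩
    beta_reduce
    rw [← hmρ, ← hmρ']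
    rfl
  obtain ⟨C, hC, h⟩ := sq_le_add_mul_sq ⟨m, rfl, hmρ⟩ key hε
  refine ⟨C, hC, fun x y => le_trans ?_ (h x y)⟩
  have h1 : 0 ≤ ρ' (p x) (p y) := hmρ' (p x) (p y) ▸ dist_nonneg
  exact pow_le_pow_left₀ h1 (le_max_right _ _) 2

theorem exists_comp_mem_approxMaps {G : Type v} {X Z : Type*} [TopologicalSpace X]
    [CompactSpace X] [TopologicalSpace Z] [SMul G X] [SMul G Z] {ρ : X → X → ℝ} {ρ' : Z → Z → ℝ}
    (hρ : IsCompatibleMetric ρ) (hρ' : IsCompatibleMetric ρ') {p : X → Z} (hp : Continuous p)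
    (hsmul : ∀ (g : G) x, p (g • x) = g • p x) {δ : ℝ} (hδ : 0 < δ) :
    ∃ δ' : ℝ, 0 < δ' ∧ ∀ (F : Finset G) (d : ℕ) (σ : G → Equiv.Perm (Fin d)),
      ∀ φ ∈ approxMaps ρ F δ' σ, p ∘ φ ∈ approxMaps ρ' F δ σ := by
  obtain ⟨C, hC, hle⟩ := hρ.exists_sq_le_add_mul_sq hρ' hp (show 0 < δ ^ 2 / 2 by positivity)
  refine ⟨Real.sqrt (δ ^ 2 / (2 * (C + 1))), by positivity, fun F d σ φ hφ s hs => ?_⟩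
  have h1 := hφ s hs
  unfold rhoTwo at h1 ⊢
  simp only [Function.comp_apply, ← hsmul]
  rw [Real.sqrt_le_sqrt_iff (by positivity), le_div_iff₀ (by positivity)] at h1
  refine Real.sqrt_le_iff.2 ⟨hδ.le, ?_⟩
  have h2 : ∑ a : Fin d, ρ' (p (φ (σ s a))) (p (s • φ a)) ^ 2 ≤
      d * (δ ^ 2 / 2) + C * ∑ a : Fin d, ρ (φ (σ s a)) (s • φ a) ^ 2 := by
    calc _ ≤ ∑ a : Fin d, (δ ^ 2 / 2 + C * ρ (φ (σ s a)) (s • φ a) ^ 2) :=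
          Finset.sum_le_sum fun a _ => hle _ _
      _ = _ := by simp [Finset.sum_add_distrib, Finset.mul_sum]
  have h3 := mul_le_mul_of_nonneg_left h2 (show (0 : ℝ) ≤ 1 / d by positivity)
  have h4 : 1 / (d : ℝ) * (d * (δ ^ 2 / 2)) ≤ δ ^ 2 / 2 := by
    rcases Nat.eq_zero_or_pos d with rfl | hd
    · simp; positivity
    · have : (d : ℝ) ≠ 0 := by positivity
      field_simp
      exact le_rfl
  have h5 : 0 ≤ 1 / (d : ℝ) * ∑ a : Fin d, ρ (φ (σ s a)) (s • φ a) ^ 2 := by positivity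
  nlinarith

/-! ### Mean dimension of systems separated by maps -/

theorem IsFiniteOpenCover.preimage {A B : Type*} [TopologicalSpace A] [TopologicalSpace B]
    {V : Set (Set B)} (hV : IsFiniteOpenCover V) {q : A → B} (hq : Continuous q) :
    IsFiniteOpenCover ((fun v => q ⁻¹' v) '' V) := by
  refine ⟨hV.finite.image _, ?_, Set.eq_univ_iff_forall.2 fun y => ?_⟩
  · rintro _ ⟨v, hv, rfl⟩
    exact (hV.isOpen v hv).preimage hq
  · obtain ⟨v, hv, hy⟩ : q y ∈ ⋃₀ V := by rw [hV.sUnion_eq]; trivial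
    exact ⟨_, ⟨v, hv, rfl⟩, hy⟩

theorem ncard_image_preimage_le {A B : Type*} {V : Set (Set B)} (hV : V.Finite) (q : A → B)
    (y : A) : Set.ncard {u | u ∈ (fun v => q ⁻¹' v) '' V ∧ y ∈ u} ≤
      Set.ncard {v | v ∈ V ∧ q y ∈ v} := by
  have hfin : {v | v ∈ V ∧ q y ∈ v}.Finite := hV.subset fun v hv => hv.1
  refine (Set.ncard_le_ncard (t := (fun v => q ⁻¹' v) '' {v | v ∈ V ∧ q y ∈ v}) ?_
    (hfin.image _)).trans (Set.ncard_image_le hfin)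
  rintro _ ⟨⟨v, hv, rfl⟩, hy⟩
  exact ⟨v, ⟨hv, hy⟩, rfl⟩

theorem coverD_eq_bot_of_isEmpty {A : Type*} [TopologicalSpace A] [IsEmpty A] (U : Set (Set A)) :
    coverD U = ⊥ := by
  refine le_bot_iff.1 ((iInf₂_le ∅ ⟨⟨Set.finite_empty, by simp, ?_⟩, fun v hv => hv.elim⟩).trans ?_)
  · exact iSup_le fun y => isEmptyElim y
  · exact Subsingleton.elim _ _

theorem coverD_nonneg {A : Type*} [TopologicalSpace A] [Nonempty A] (U : Set (Set A)) :
    0 ≤ coverD U := by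
  refine le_iInf₂ fun V hV => ?_
  obtain ⟨y⟩ := ‹Nonempty A›
  refine le_trans ?_ (le_iSup _ y)
  obtain ⟨v, hv, hy⟩ : y ∈ ⋃₀ V := by rw [hV.1.sUnion_eq]; trivial
  have h : 0 < Set.ncard {v | v ∈ V ∧ y ∈ v} :=
    (Set.ncard_pos (hV.1.finite.subset fun v hv => hv.1)).2 ⟨v, hv, hy⟩
  have h' : (1 : ℝ) ≤ Set.ncard {v | v ∈ V ∧ y ∈ v} := by exact_mod_cast h
  exact EReal.coe_nonneg.2 (by linarith)

/-- Subadditivity of `𝒟`: if the join of the pullbacks of covers `O n` along maps `q n` refines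
`U`, then `𝒟(U)` is bounded by the sum of the bounds on the `𝒟(O n)`. -/
theorem coverD_le_sum {A : Type*} [TopologicalSpace A] [NormalSpace A] {ι : Type*} [Fintype ι]
    {B : ι → Type*} [∀ n, TopologicalSpace (B n)] {q : ∀ n, A → B n} (hq : ∀ n, Continuous (q n))
    {U : Set (Set A)} {O : ∀ n, Set (Set (B n))}
    (hU : ∀ o : ∀ n, Set (B n), (∀ n, o n ∈ O n) → ∃ u ∈ U, ∀ y, (∀ n, q n y ∈ o n) → y ∈ u)
    {c : ι → ℝ} (hc : ∀ n, coverD (O n) < (c n : EReal)) : coverD U ≤ ((∑ n, c n : ℝ) : EReal) := by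
  have h : ∀ n, ∃ V : Set (Set (B n)), (IsFiniteOpenCover V ∧ Refines V (O n)) ∧
      coverOrd V < (c n : EReal) := by
    intro n
    obtain ⟨V, hV⟩ := iInf_lt_iff.1 (hc n)
    obtain ⟨hV, hlt⟩ := iInf_lt_iff.1 hV
    exact ⟨V, hV, hlt⟩
  choose V hV hlt using h
  obtain ⟨W, hW, hWV, hWord⟩ := exists_common_refinement
    (fun n => (fun v => q n ⁻¹' v) '' V n) fun n => (hV n).1.preimage (hq n)
  refine (iInf₂_le W ⟨hW, ?_⟩).trans
    (iSup_le fun y => EReal.coe_le_coe_iff.2 ?_)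
  rotate_left
  · intro w hw
    have h : ∀ n, ∃ o ∈ O n, ∀ y ∈ w, q n y ∈ o := by
      intro n
      obtain ⟨_, ⟨v, hv, rfl⟩, hwv⟩ := hWV w hw n
      obtain ⟨o, ho, hvo⟩ := (hV n).2 v hv
      exact ⟨o, ho, fun y hy => hvo (hwv hy)⟩
    choose o ho hwo using h
    obtain ⟨u, hu, hyu⟩ := hU o ho
    exact ⟨u, hu, fun y hy => hyu y fun n => hwo n y hy⟩
  · refine (hWord y).trans (Finset.sum_le_sum fun n _ => ?_)
    have h1 : (Set.ncard {u | u ∈ (fun v => q n ⁻¹' v) '' V n ∧ y ∈ u} : ℝ) ≤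
        Set.ncard {v | v ∈ V n ∧ q n y ∈ v} := by
      exact_mod_cast ncard_image_preimage_le (hV n).1.finite (q n) y
    have h2 : (((Set.ncard {v | v ∈ V n ∧ q n y ∈ v} : ℝ) - 1 : ℝ) : EReal) < c n :=
      (le_iSup (fun z => (((Set.ncard {v | v ∈ V n ∧ z ∈ v} : ℝ) - 1 : ℝ) : EReal))
        (q n y)).trans_lt (hlt n)
    linarith [EReal.coe_lt_coe_iff.1 h2]

theorem approxMaps_mono {G : Type v} {X : Type*} [SMul G X] {ρ : X → X → ℝ} {F F' : Finset G} {δ δ' : ℝ}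
    (hF : F ⊆ F') (hδ : δ' ≤ δ) {d : ℕ} (σ : G → Equiv.Perm (Fin d)) :
    approxMaps ρ F' δ' σ ⊆ approxMaps ρ F δ σ :=
  fun _ hφ s hs => (hφ s (hF hs)).trans hδ

variable {G : Type v} [Group G] (S : SoficApproximation G)

theorem isCompatibleMetric_metrizableSpaceMetric (X : Type*) [TopologicalSpace X]
    [TopologicalSpace.MetrizableSpace X] :
    IsCompatibleMetric (TopologicalSpace.metrizableSpaceMetric X).dist :=
  ⟨TopologicalSpace.metrizableSpaceMetric X, rfl, fun _ _ => rfl⟩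

/-- Nonnegativity of the mean dimension only says that approximately equivariant maps exist, for
arbitrarily large indices. -/
theorem mdim_nonneg_iff {X : Type*} [TopologicalSpace X] [TopologicalSpace.MetrizableSpace X]
    [SMul G X] : 0 ≤ mdim S X ↔ ∀ F : Finset G, F.Nonempty → ∀ δ : ℝ, 0 < δ →
      ∃ᶠ i in atTop, (approxMaps (TopologicalSpace.metrizableSpaceMetric X).dist F δ
        (S.σ i)).Nonempty := by
  have hd : ∀ i, (0 : EReal) < (S.d i : EReal) := fun i => by exact_mod_cast S.d_pos i
  constructor
  · intro h F hF δ hδ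
    by_contra hne
    have hev : ∀ᶠ i in atTop, approxMaps (TopologicalSpace.metrizableSpaceMetric X).dist F δ
        (S.σ i) = ∅ := by
      filter_upwards [not_frequently.1 hne] with i hi
      exact Set.not_nonempty_iff_eq_empty.1 hi
    have hbot : mdim S X ≤ ⊥ := by
      refine iSup₂_le fun U _ => (iInf₂_le F hF).trans ((iInf₂_le δ hδ).trans ?_)
      refine limsup_le_of_le (h := ?_)
      filter_upwards [hev] with i hi
      have : IsEmpty (approxMaps (TopologicalSpace.metrizableSpaceMetric X).dist F δ (S.σ i)) :=
        Set.isEmpty_coe_sort.2 hi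
      rw [coverD_eq_bot_of_isEmpty, EReal.bot_div_of_pos_ne_top (hd i) (EReal.natCast_ne_top _)]
    exact absurd (h.trans hbot) (by simp)
  · intro h
    refine le_iSup₂_of_le {Set.univ} ⟨Set.finite_singleton _, by simp, by simp⟩ ?_
    refine le_iInf₂ fun F hF => le_iInf₂ fun δ hδ => le_limsup_of_frequently_le' ?_
    refine (h F hF δ hδ).mono fun i hi => ?_
    have := hi.to_subtype
    exact EReal.div_nonneg (coverD_nonneg _) (hd i).le

/-- Approximately equivariant maps push forward along equivariant maps. -/
theorem mdim_nonneg_of_map {X Z : Type*} [TopologicalSpace X] [CompactSpace X]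
    [TopologicalSpace.MetrizableSpace X] [TopologicalSpace Z] [TopologicalSpace.MetrizableSpace Z]
    [SMul G X] [SMul G Z] {p : X → Z} (hp : Continuous p) (hsmul : ∀ (g : G) x, p (g • x) = g • p x)
    (h : 0 ≤ mdim S X) : 0 ≤ mdim S Z := by
  rw [mdim_nonneg_iff] at h ⊢
  intro F hF δ hδ
  obtain ⟨δ', hδ', hmap⟩ := exists_comp_mem_approxMaps
    (isCompatibleMetric_metrizableSpaceMetric X) (isCompatibleMetric_metrizableSpaceMetric Z)
    hp hsmul hδ
  exact (h F hF δ' hδ').mono fun i ⟨φ, hφ⟩ => ⟨p ∘ φ, hmap F _ _ φ hφ⟩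

theorem nonempty_of_mdim_nonneg {X : Type*} [TopologicalSpace X]
    [TopologicalSpace.MetrizableSpace X] [SMul G X] (h : 0 ≤ mdim S X) : Nonempty X := by
  obtain ⟨i, φ, -⟩ :=
    ((mdim_nonneg_iff S).1 h {1} (Finset.singleton_nonempty 1) 1 one_pos).exists
  exact ⟨φ ⟨0, S.d_pos i⟩⟩

theorem exists_eventually_coverD_lt {Z : Type*} [TopologicalSpace Z]
    [TopologicalSpace.MetrizableSpace Z] [SMul G Z] (h : mdim S Z ≤ 0) {O : Set (Set Z)}
    (hO : IsFiniteOpenCover O) {ε : ℝ} (hε : 0 < ε) :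
    ∃ (F : Finset G) (δ : ℝ), 0 < δ ∧ ∀ᶠ i in atTop,
      coverD (restrictCover (coverPow O (S.d i))
        (approxMaps (TopologicalSpace.metrizableSpaceMetric Z).dist F δ (S.σ i))) <
          ((ε * S.d i : ℝ) : EReal) := by
  have h0 : soficD S (TopologicalSpace.metrizableSpaceMetric Z).dist O < (ε : EReal) :=
    ((le_iSup₂ (f := fun U (_ : IsFiniteOpenCover U) => soficD S _ U) O hO).trans h).trans_lt
      (EReal.coe_pos.2 hε)
  obtain ⟨F, h1⟩ := iInf_lt_iff.1 h0
  obtain ⟨-, h2⟩ := iInf_lt_iff.1 h1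
  obtain ⟨δ, h3⟩ := iInf_lt_iff.1 h2
  obtain ⟨hδ, h4⟩ := iInf_lt_iff.1 h3
  refine ⟨F, δ, hδ, (eventually_lt_of_limsup_lt h4).mono fun i hi => ?_⟩
  have hd : (0 : EReal) < (S.d i : EReal) := by exact_mod_cast S.d_pos i
  rw [EReal.div_lt_iff hd (EReal.natCast_ne_top _)] at hi
  rw [EReal.coe_mul]
  exact hi

/-- Nonpositive mean dimension passes to every system that is separated by equivariant maps into
systems with this property: in particular to products and to subsystems. -/
theorem mdim_nonpos_of_separating {Y : Type*} [TopologicalSpace Y] [CompactSpace Y]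
    [TopologicalSpace.MetrizableSpace Y] [Nonempty Y] [SMul G Y] {ι : Type*} {Z : ι → Type*}
    [∀ n, TopologicalSpace (Z n)] [∀ n, CompactSpace (Z n)]
    [∀ n, TopologicalSpace.MetrizableSpace (Z n)] [∀ n, SMul G (Z n)] {p : ∀ n, Y → Z n}
    (hp : ∀ n, Continuous (p n)) (hsmul : ∀ n (g : G) y, p n (g • y) = g • p n y)
    (hsep : ∀ x y, (∀ n, p n x = p n y) → x = y) (hZ : ∀ n, mdim S (Z n) ≤ 0) :
    mdim S Y ≤ 0 := by
  classical
  refine iSup₂_le fun U hU => EReal.le_of_forall_lt_iff_le.1 fun ε hε => ?_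
  have hε : 0 < ε := EReal.coe_pos.1 hε
  obtain ⟨J, O, hO, hOU⟩ := exists_finset_covers_of_separating p hp hsep hU
  set η : ℝ := ε / (J.card + 1) with hη
  have hη0 : 0 < η := by positivity
  choose F δ hδ hev using fun n => exists_eventually_coverD_lt S (hZ n) (hO n) hη0
  choose δ' hδ' hmap using fun n => exists_comp_mem_approxMaps (G := G)
    (isCompatibleMetric_metrizableSpaceMetric Y) (isCompatibleMetric_metrizableSpaceMetric (Z n))
    (hp n) (hsmul n) (hδ n)
  obtain ⟨δ₀, hδ₀, hδ₀le⟩ : ∃ δ₀ : ℝ, 0 < δ₀ ∧ ∀ n ∈ J, δ₀ ≤ δ' n := by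
    rcases J.eq_empty_or_nonempty with rfl | hJ
    · exact ⟨1, one_pos, by simp⟩
    · exact ⟨J.inf' hJ δ', (Finset.lt_inf'_iff hJ).2 fun n _ => hδ' n,
        fun n hn => Finset.inf'_le _ hn⟩
  refine (iInf₂_le (insert 1 (J.biUnion F)) (Finset.insert_nonempty _ _)).trans
    ((iInf₂_le δ₀ hδ₀).trans (limsup_le_of_le (h := ?_)))
  filter_upwards [(Filter.eventually_all_finset J).2 fun n _ => hev n] with i hi
  have hd : (0 : EReal) < (S.d i : EReal) := by exact_mod_cast S.d_pos i
  rw [EReal.div_le_iff_le_mul hd (EReal.natCast_ne_top _)]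
  set A := approxMaps (TopologicalSpace.metrizableSpaceMetric Y).dist (insert 1 (J.biUnion F)) δ₀
    (S.σ i)
  have hmem : ∀ (n : J) (φ : A), p n ∘ φ.1 ∈
      approxMaps (TopologicalSpace.metrizableSpaceMetric (Z n)).dist (F n) (δ n) (S.σ i) :=
    fun n φ => hmap n (F n) _ _ _ (approxMaps_mono
      ((Finset.subset_biUnion_of_mem F n.2).trans (Finset.subset_insert _ _)) (hδ₀le n n.2) _ φ.2)
  refine (coverD_le_sum (q := fun (n : J) (φ : A) => ⟨p n ∘ φ.1, hmem n φ⟩) (fun n => ?_)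
    (fun o ho => ?_) fun n => hi n n.2).trans ?_
  · exact Continuous.subtype_mk (continuous_pi fun a =>
      (hp n).comp ((continuous_apply a).comp continuous_subtype_val)) _
  · -- Coordinatewise, boxes of members of the `O n` pull back into members of `U`.
    have hbox : ∀ n : J, ∃ f : Fin (S.d i) → Set (Z n), (∀ a, f a ∈ O n) ∧
        o n = Subtype.val ⁻¹' Set.pi Set.univ f := by
      intro n
      obtain ⟨_, ⟨f, hf, rfl⟩, hfo⟩ := ho n
      exact ⟨f, hf, hfo.symm⟩
    choose f hf hfo using hbox
    have hu : ∀ a, ∃ u ∈ U, ∀ y, (∀ n : J, p n y ∈ f n a) → y ∈ u := by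
      intro a
      obtain ⟨u, hu, hyu⟩ := hOU (fun n => if hn : n ∈ J then f ⟨n, hn⟩ a else ∅)
        fun n hn => by simpa [hn] using hf ⟨n, hn⟩ a
      exact ⟨u, hu, fun y hy => hyu y fun n hn => by simpa [hn] using hy ⟨n, hn⟩⟩
    choose u hu hyu using hu
    refine ⟨_, ⟨_, ⟨u, hu, rfl⟩, rfl⟩, fun φ hφ a _ => hyu a _ fun n => ?_⟩
    have := hφ n
    rw [hfo n] at this
    exact this a trivial
  · have h1 : ∑ _n : J, η * (S.d i : ℝ) ≤ S.d i * ε := by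
      have h2 : (J.card : ℝ) * η ≤ ε := by
        rw [hη, mul_div_assoc', div_le_iff₀ (by positivity)]
        nlinarith
      have h3 : (0 : ℝ) ≤ S.d i := by positivity
      simp only [Finset.sum_const, Finset.card_univ, Fintype.card_coe, nsmul_eq_mul]
      nlinarith
    exact_mod_cast EReal.coe_le_coe_iff.2 h1

/-! ### The largest factor -/

/-- A factor of the system `X` whose sofic mean topological dimension is nonpositive. -/
structure NonposFactor {G : Type v} [Group G] (S : SoficApproximation G) (X : Type u)
    [TopologicalSpace X] [SMul G X] where
  Z : Type u
  [top : TopologicalSpace Z]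
  [compact : CompactSpace Z]
  [metrizable : TopologicalSpace.MetrizableSpace Z]
  [action : MulAction G Z]
  [continuousSMul : ContinuousConstSMul G Z]
  map : X → Z
  isFactorMap : IsFactorMap G map
  mdim_nonpos : mdim S Z ≤ 0

namespace NonposFactor

attribute [instance] top compact metrizable action continuousSMul

variable {G : Type v} [Group G] {S : SoficApproximation G} {X : Type u} [TopologicalSpace X]

/-- The pairs of points that a factor separates. -/
def separated [SMul G X] (P : NonposFactor S X) : Set (X × X) :=
  {q | P.map q.1 ≠ P.map q.2}

theorem isOpen_separated [SMul G X] (P : NonposFactor S X) : IsOpen P.separated :=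
  isOpen_ne_fun (P.isFactorMap.continuous.comp continuous_fst)
    (P.isFactorMap.continuous.comp continuous_snd)

/-- Countably many factors separate as many pairs of points as all factors together, since
`X × X` is second countable. -/
theorem exists_countable_separated [SMul G X] [SecondCountableTopology X] :
    ∃ T : Set (NonposFactor S X), T.Countable ∧
      ∀ (P : NonposFactor S X) (x y : X), (∀ Q ∈ T, Q.map x = Q.map y) → P.map x = P.map y := by
  obtain ⟨T, hT, hTU⟩ := TopologicalSpace.isOpen_iUnion_countable
    (fun P : NonposFactor S X => P.separated) fun P => P.isOpen_separated
  refine ⟨T, hT, fun P x y h => ?_⟩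
  by_contra hne
  have hmem : (x, y) ∈ ⋃ P : NonposFactor S X, P.separated := Set.mem_iUnion.2 ⟨P, hne⟩
  rw [← hTU] at hmem
  obtain ⟨Q, hQ, hxy⟩ := Set.mem_iUnion₂.1 hmem
  exact hxy (h Q hQ)

/-- The image of `X` in the product of a family of factors. -/
def range [SMul G X] {ι : Type*} (P : ι → NonposFactor S X) : SubMulAction G (∀ n, (P n).Z) where
  carrier := Set.range fun x n => (P n).map x
  smul_mem' := by
    rintro g _ ⟨x, rfl⟩
    exact ⟨g • x, funext fun n => (P n).isFactorMap.map_smul g x⟩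

end NonposFactor

end SoficMeanDim

open SoficMeanDim in
theorem mainTheorem7 {G : Type v} [Group G] [Countable G] (S : SoficApproximation G)
    (X : Type u) [TopologicalSpace X] [CompactSpace X] [TopologicalSpace.MetrizableSpace X]
    [MulAction G X] [ContinuousConstSMul G X] (hX : 0 ≤ SoficMeanDim.mdim S X) :
    ∃ (Y : Type u) (_ : TopologicalSpace Y) (_ : CompactSpace Y)
      (_ : TopologicalSpace.MetrizableSpace Y) (_ : MulAction G Y) (_ : ContinuousConstSMul G Y)
      (π : X → Y),
      SoficMeanDim.IsFactorMap G π ∧ SoficMeanDim.mdim S Y = 0 ∧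
      ∀ (Z : Type u) [TopologicalSpace Z] [CompactSpace Z] [TopologicalSpace.MetrizableSpace Z]
        [MulAction G Z] [ContinuousConstSMul G Z] (πZ : X → Z),
        SoficMeanDim.IsFactorMap G πZ → SoficMeanDim.mdim S Z = 0 →
        ∃! θ : Y → Z, SoficMeanDim.IsFactorMap G θ ∧ θ ∘ π = πZ := by
  obtain ⟨T, hT, hsep⟩ := NonposFactor.exists_countable_separated (S := S) (X := X)
  -- `NonposFactor` raises the universe level; a countable index type can be taken in `Type`.
  have := hT.to_subtype
  let P : Shrink.{0} T → NonposFactor S X := fun n => ((equivShrink.{0} T).symm n).1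
  have : Countable (Shrink.{0} T) := (equivShrink.{0} T).symm.injective.countable
  have hPsep : ∀ (Q : NonposFactor S X) (x y : X), (∀ n, (P n).map x = (P n).map y) →
      Q.map x = Q.map y := by
    refine fun Q x y h => hsep Q x y fun R hR => ?_
    obtain ⟨n, rfl⟩ : ∃ n, P n = R :=
      ⟨equivShrink.{0} T ⟨R, hR⟩, congrArg Subtype.val (Equiv.symm_apply_apply _ _)⟩
    exact h n
  let Y := NonposFactor.range P
  let π : X → Y := fun x => ⟨fun n => (P n).map x, x, rfl⟩
  have hπc : Continuous π :=
    (continuous_pi fun n => (P n).isFactorMap.continuous).subtype_mk _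
  have hπs : Function.Surjective π := by
    rintro ⟨_, x, rfl⟩
    exact ⟨x, rfl⟩
  have hπ : IsFactorMap G π :=
    ⟨hπc, hπs, fun g x => Subtype.ext (funext fun n => (P n).isFactorMap.map_smul g x)⟩
  have hYc : CompactSpace Y :=
    ⟨by rw [← hπs.range_eq]; exact isCompact_range hπc⟩
  have hYm : TopologicalSpace.MetrizableSpace Y :=
    inferInstanceAs (TopologicalSpace.MetrizableSpace (Y : Set (∀ n, (P n).Z)))
  have hYs : ContinuousConstSMul G Y :=
    ⟨fun g => (continuous_subtype_val.const_smul g).subtype_mk _⟩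
  have hXne := nonempty_of_mdim_nonneg S hX
  have hYne : Nonempty Y := hXne.map π
  have hYle : mdim S Y ≤ 0 := by
    refine mdim_nonpos_of_separating S (p := fun n (y : Y) => y.1 n)
      (fun n => (continuous_apply n).comp continuous_subtype_val) (fun n g y => rfl)
      (fun y y' h => Subtype.ext (funext h)) fun n => (P n).mdim_nonpos
  refine ⟨Y, inferInstance, hYc, hYm, inferInstance, hYs, π, hπ,
    le_antisymm hYle (mdim_nonneg_of_map S hπc hπ.map_smul hX), ?_⟩
  intro Z _ _ _ _ _ πZ hπZ hZ
  have hfac : ∀ x y, π x = π y → πZ x = πZ y := fun x y h =>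
    hPsep ⟨Z, πZ, hπZ, hZ.le⟩ x y fun n => congrFun (congrArg Subtype.val h) n
  have hθ : (fun y => πZ (Function.surjInv hπs y)) ∘ π = πZ :=
    funext fun x => hfac _ _ (Function.surjInv_eq hπs (π x))
  refine ⟨fun y => πZ (Function.surjInv hπs y), ⟨⟨?_, ?_, ?_⟩, hθ⟩, ?_⟩
  · rw [(hπc.isClosedMap.isQuotientMap hπc hπs).continuous_iff, hθ]
    exact hπZ.continuous
  · refine Function.Surjective.of_comp (g := π) ?_
    rw [hθ]
    exact hπZ.surjective
  · intro g y
    rw [← hπZ.map_smul]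
    refine hfac _ _ ?_
    rw [hπ.map_smul, Function.surjInv_eq hπs, Function.surjInv_eq hπs]
  · rintro θ ⟨-, h⟩
    exact hπs.injective_comp_right (h.trans hθ.symm)
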